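/- Theorem. A BDD here means a quasi-reduced (multi-terminal) OBDD: a layered decision diagram over $n$ Boolean variables in which no ply is skipped, every node is reachable from the root, equal sub-DAGs are shared, and there is one leaf per terminal value; $|B|$ denotes the number of nodes of $B$ (leaves included). A CFLOBDD at level $k$ is a finite hierarchy of groupings, all reachable along call edges from a single level-$k$ head. Each grouping has one entry vertex and an ordered set of exit vertices. A level-$0$ grouping reads one variable and is either a fork grouping (two exits) or a don't-care grouping (one exit). A grouping $g$ at level $l\ge 1$ has an ordered set of middle vertices, an A-call to a level-$(l-1)$ grouping with a return tuple from the exits of the callee to the middle vertices of $g$, and for each middle vertex a B-call to a level-$(l-1)$ grouping with a return tuple from the exits of the callee to the exits of $g$. The exits of the head carry terminal values. An assignment to $2^k$ variables is interpreted by the matched path: the A-callee reads the first half of the variables, and the B-callee of the middle vertex returned to reads the second half, returning along the matching edges. The following invariants hold: (1) A-return tuples are the identity onto the middle vertices; (2) B-return tuples are injective, each compactly extends the set of exits targeted by the preceding ones (the new exits appear in the tuple in order, without gaps), and every exit of $g$ is targeted by some B-return edge; (3) there are no two separate instances of equal sub-structures; (4) two B-connections of the same grouping with equal callees have different return tuples;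 (5) the exits of the head have distinct terminal values. Then there is an absolute constant $c$ such that the following holds. Let $V$ be any set of values, $k\ge 0$, $f:\{0,1\}^{2^k}\to V$, and let $B$ and $C$ be a BDD and a level-$k$ CFLOBDD that represent $f$ with the same variable ordering. Then the number $|V(C)|$ of vertices (entry, middle and exit vertices of all groupings) of $C$ satisfies $|V(C)|\le c\,|B|^2$; that is, $|V(C)|=O(|B|^2)$. -/

import Mathlib

/-! ### Binary decision diagrams without ply-skipping -/

/-- A layered, multi-terminal decision diagram over `n` Boolean variables: `Node d` is the finite
set of nodes at depth `d`. Every node at a depth `d < n` has a `false`-successor and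
a `true`-successor at depth `d + 1`; the nodes at depth `n` carry terminal values. -/
structure DecisionDiagram (n : ℕ) (V : Type*) where
  Node : ℕ → Type
  fintypeNode : ∀ d, Fintype (Node d)
  root : Node 0
  child : ∀ {d : ℕ}, d < n → Node d → Bool → Node (d + 1)
  value : Node n → V

namespace DecisionDiagram

variable {n : ℕ} {V : Type*}

attribute [instance] DecisionDiagram.fintypeNode

/-- The node reached from the root after interpreting the first `d` variables. -/
def walk (B : DecisionDiagram n V) (x : Fin n → Bool) : ∀ d : ℕ, d ≤ n → B.Node d
  | 0, _ => B.root
  | d + 1, h => B.child h (B.walk x d (Nat.le_of_succ_le h)) (x ⟨d, h⟩)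

/-- The result of interpreting the assignment `x`, where `x i` is the value of the `i`-th variable
that is read. -/
def eval (B : DecisionDiagram n V) (x : Fin n → Bool) : V :=
  B.value (B.walk x n le_rfl)

/-- The nodes that can be reached from the root. -/
inductive Reachable (B : DecisionDiagram n V) : ∀ {d : ℕ}, B.Node d → Prop
  | root : Reachable B B.root
  | child {d : ℕ} (h : d < n) {u : B.Node d} (b : Bool) :
      Reachable B u → Reachable B (B.child h u b)

/-- A quasi-reduced (multi-terminal) OBDD: every node is reachable from the root, and equal
sub-DAGs are shared, i.e. there is at most one leaf for each terminal value and no two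
different nodes at the same depth have the same `false`-successor and the same
`true`-successor. (Don't-care nodes are kept: plies are never skipped.) -/
structure IsBDD (B : DecisionDiagram n V) : Prop where
  reachable : ∀ {d : ℕ} (u : B.Node d), B.Reachable u
  shared : ∀ {d : ℕ} (h : d < n) (u v : B.Node d),
    (∀ b : Bool, B.child h u b = B.child h v b) → u = v
  value_injective : Function.Injective B.value

/-- `B` represents `f` under the variable ordering `Ord`: the `i`-th variable read is
`Ord i`. -/
def Represents (B : DecisionDiagram n V) (Ord : Equiv.Perm (Fin n))
    (f : (Fin n → Bool) → V) : Prop :=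
  ∀ x : Fin n → Bool, B.eval (fun i => x (Ord i)) = f x

/-- `|B|`, the number of nodes (at all depths `0, …, n`, leaves included). -/
def size (B : DecisionDiagram n V) : ℕ :=
  ∑ d ∈ Finset.range (n + 1), Fintype.card (B.Node d)

end DecisionDiagram

/-! ### CFLOBDDs -/

/-- The basic structure of a (mock-)CFLOBDD at level `k` with terminal values in `V`.
`Grp l` is the finite set of groupings at level `l`. Exit vertices and middle vertices of a
grouping are numbered from `0`, in their given order.
* A level-`0` grouping is a fork grouping (two exits) or a don't-care grouping (one exit).
* A grouping `g` at level `l + 1` has `numMid g` middle vertices, an A-call edge to `callA g`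
  with return edges `retA g` from the exits of the callee to the middle vertices of `g`, and, for
  each middle vertex `m`, a B-call edge to `callB g m` with return edges `retB g m` from the exits
  of the callee to the exits of `g`.
* `value` gives the value edges from the exits of the head to terminal values. -/
structure MockCFLOBDD (k : ℕ) (V : Type*) where
  Grp : ℕ → Type
  fintypeGrp : ∀ l, Fintype (Grp l)
  numExits : ∀ {l : ℕ}, Grp l → ℕ
  isFork : Grp 0 → Bool
  numExits_zero : ∀ g : Grp 0, numExits g = if isFork g then 2 else 1
  numMid : ∀ {l : ℕ}, Grp (l + 1) → ℕ
  callA : ∀ {l : ℕ}, Grp (l + 1) → Grp l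
  retA : ∀ {l : ℕ} (g : Grp (l + 1)), Fin (numExits (callA g)) → Fin (numMid g)
  callB : ∀ {l : ℕ} (g : Grp (l + 1)), Fin (numMid g) → Grp l
  retB : ∀ {l : ℕ} (g : Grp (l + 1)) (m : Fin (numMid g)),
    Fin (numExits (callB g m)) → Fin (numExits g)
  head : Grp k
  value : Fin (numExits head) → V

namespace MockCFLOBDD

variable {k : ℕ} {V : Type*}

attribute [instance] MockCFLOBDD.fintypeGrp

/-- The groupings that can be reached from the head along call edges. -/
inductive Reachable (C : MockCFLOBDD k V) : ∀ {l : ℕ}, C.Grp l → Prop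
  | head : Reachable C C.head
  | callA {l : ℕ} {g : C.Grp (l + 1)} : Reachable C g → Reachable C (C.callA g)
  | callB {l : ℕ} {g : C.Grp (l + 1)} (m : Fin (C.numMid g)) :
      Reachable C g → Reachable C (C.callB g m)

/-- The exit vertex of `g` at which the matched path for the assignment `x` to `2 ^ l` variables
leaves the proto-CFLOBDD headed by `g`. At level `0` the next variable is read. At level `l + 1`
the path goes through the A-callee, which reads the first `2 ^ l` variables, comes back along the
matching A-return edge to a middle vertex `m`, goes through the B-callee of `m`, which reads the
other `2 ^ l` variables, and comes back along the matching B-return edge. -/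
def exitOf (C : MockCFLOBDD k V) :
    ∀ {l : ℕ} (g : C.Grp l), (Fin (2 ^ l) → Bool) → Fin (C.numExits g)
  | 0, g, x => ⟨if C.isFork g && x 0 then 1 else 0, by
      rw [C.numExits_zero g]; cases C.isFork g <;> cases x 0 <;> simp⟩
  | l + 1, g, x =>
      let m := C.retA g (C.exitOf (C.callA g)
        (fun i => x ⟨i, by have := i.isLt; rw [pow_succ]; omega⟩))
      C.retB g m (C.exitOf (C.callB g m)
        (fun i => x ⟨2 ^ l + i, by have := i.isLt; rw [pow_succ]; omega⟩))

/-- The result of interpreting the assignment `x`, where `x i` is the value of the `i`-th variable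
that is read. -/
def eval (C : MockCFLOBDD k V) (x : Fin (2 ^ k) → Bool) : V :=
  C.value (C.exitOf C.head x)

/-- The return tuple of the A-connection of `g`. -/
def tupleA (C : MockCFLOBDD k V) {l : ℕ} (g : C.Grp (l + 1)) : List ℕ :=
  List.ofFn fun e => (C.retA g e : ℕ)

/-- The return tuple of the B-connection of the middle vertex `m` of `g`. -/
def tupleB (C : MockCFLOBDD k V) {l : ℕ} (g : C.Grp (l + 1)) (m : Fin (C.numMid g)) : List ℕ :=
  List.ofFn fun e => (C.retB g m e : ℕ)

/-- Equality (up to isomorphism) of the proto-CFLOBDDs headed by two groupings, defined inductively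
on their hierarchical structure. -/
def SameProto (C : MockCFLOBDD k V) : ∀ {l : ℕ}, C.Grp l → C.Grp l → Prop
  | 0, g, h => C.isFork g = C.isFork h
  | _ + 1, g, h =>
      C.numExits g = C.numExits h ∧
      C.SameProto (C.callA g) (C.callA h) ∧ C.tupleA g = C.tupleA h ∧
      ∃ e : C.numMid g = C.numMid h, ∀ m : Fin (C.numMid g),
        C.SameProto (C.callB g m) (C.callB h (Fin.cast e m)) ∧
        C.tupleB g m = C.tupleB h (Fin.cast e m)

/-- The number of exit vertices of `g` up to and including the rightmost one that is a target of
the B-connections of the middle vertices before `m` (`0` if there is no such target). -/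
def exitsBefore (C : MockCFLOBDD k V) {l : ℕ} (g : C.Grp (l + 1)) (m : Fin (C.numMid g)) : ℕ :=
  (Finset.univ.filter (· < m)).sup fun j => Finset.univ.sup fun e => (C.retB g j e : ℕ) + 1

/-- The structural invariants that make a mock-CFLOBDD a CFLOBDD. -/
structure IsCFLOBDD (C : MockCFLOBDD k V) : Prop where
  /-- The structure consists of the head and the groupings to which it is connected. -/
  reachable : ∀ {l : ℕ} (g : C.Grp l), C.Reachable g
  /-- A-returns map the exits of the callee one-to-one, in order, onto the middle vertices. -/
  retA_onto : ∀ {l : ℕ} (g : C.Grp (l + 1)), C.tupleA g = List.range (C.numMid g)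
  /-- There are no repetitions in a B-return tuple. -/
  retB_injective : ∀ {l : ℕ} (g : C.Grp (l + 1)) (m : Fin (C.numMid g)),
    Function.Injective (C.retB g m)
  /-- Each B-return tuple compactly extends the exits used by the previous ones: its sub-sequence
  of exits beyond those is `n, n + 1, …, n + r - 1`, where `n` is the number of exits before. -/
  retB_compact : ∀ {l : ℕ} (g : C.Grp (l + 1)) (m : Fin (C.numMid g)), ∃ r : ℕ,
    (C.tupleB g m).filter (fun e => C.exitsBefore g m ≤ e) = List.range' (C.exitsBefore g m) r
  /-- Every exit vertex is the target of some B-return edge. -/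
  retB_cover : ∀ {l : ℕ} (g : C.Grp (l + 1)) (e : Fin (C.numExits g)),
    ∃ m : Fin (C.numMid g), e ∈ Set.range (C.retB g m)
  /-- There are no two separate instances of equal proto-CFLOBDDs. -/
  shared : ∀ {l : ℕ} (g h : C.Grp l), C.SameProto g h → g = h
  /-- B-connections of different middle vertices of a grouping that call equal proto-CFLOBDDs have
  different return tuples. -/
  retB_distinct : ∀ {l : ℕ} (g : C.Grp (l + 1)) (m m' : Fin (C.numMid g)), m ≠ m' →
    C.SameProto (C.callB g m) (C.callB g m') → C.tupleB g m ≠ C.tupleB g m'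
  /-- The exits of the head are mapped to distinct terminal values. -/
  value_injective : Function.Injective C.value

/-- `C` represents `f` under the variable ordering `Ord`: the `i`-th variable read is
`Ord i`. -/
def Represents (C : MockCFLOBDD k V) (Ord : Equiv.Perm (Fin (2 ^ k)))
    (f : (Fin (2 ^ k) → Bool) → V) : Prop :=
  ∀ x : Fin (2 ^ k) → Bool, C.eval (fun i => x (Ord i)) = f x

/-- The number of middle vertices of a grouping; there are none at level `0`. -/
def numMiddle (C : MockCFLOBDD k V) : ∀ {l : ℕ}, C.Grp l → ℕ
  | 0, _ => 0
  | _ + 1, g => C.numMid g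

/-- The number of vertices of `C`: each grouping has one entry vertex, its middle vertices and
its exit vertices. -/
def numVertices (C : MockCFLOBDD k V) : ℕ :=
  ∑ l ∈ Finset.range (k + 1), ∑ g : C.Grp l, (1 + C.numMiddle g + C.numExits g)

end MockCFLOBDD

/-! Every grouping of `C` mirrors a piece of `B`: for some depth `d` and prefix `X`, its exits
partition the next `2 ^ l` bits exactly as the nodes of `B` at depth `d + 2 ^ l` do (`Tracks`). The
head does so because values are distinct on both sides, and the property passes to A-callees and
B-callees. Hence exits and middle vertices are bounded by widths of `B`.

Canonicity (`IsCFLOBDD.eq_of_exit_eq_iff`) says that a grouping is determined by its partition. The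
node of `B` reached by `X` determines that partition, so at each level distinct groupings belong to
distinct nodes of `B`.

It remains to sum over nodes and levels. For a fixed node at depth `d`, the relevant widths sit at
the depths `d + 2 ^ l`, which differ from level to level, so they add up to at most `3 * B.size`
with no factor for the number of levels. Summing over the nodes gives `3 * B.size ^ 2`.

Assignments are infinite bit streams, so that all levels and depths share one domain. -/

/-- The stream that starts with the first `d` bits of `s` and continues with `t`. -/
def splice (d : ℕ) (s t : ℕ → Bool) : ℕ → Bool := fun i => if i < d then s i else t (i - d)

theorem splice_of_lt {d i : ℕ} (s t : ℕ → Bool) (h : i < d) : splice d s t i = s i := if_pos h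

@[simp] theorem splice_add (d i : ℕ) (s t : ℕ → Bool) : splice d s t (d + i) = t i := by
  simp [splice]

@[simp] theorem splice_zero (s t : ℕ → Bool) : splice 0 s t = t := by
  funext i
  simp [splice]

theorem splice_splice (d m : ℕ) (s t u : ℕ → Bool) :
    splice d s (splice m t u) = splice (d + m) (splice d s t) u := by
  funext i
  simp only [splice]
  grind

/-! ### Matched paths along streams -/

namespace MockCFLOBDD

variable {k : ℕ} {V : Type*} {C : MockCFLOBDD k V}

/-- The exit vertex of `g` reached by the first `2 ^ l` bits of the stream `s`. -/
def exit (C : MockCFLOBDD k V) {l : ℕ} (g : C.Grp l) (s : ℕ → Bool) : Fin (C.numExits g) :=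
  C.exitOf g fun i => s i

/-- The middle vertex of `g` reached by the first `2 ^ l` bits of the stream `s`. -/
def mid (C : MockCFLOBDD k V) {l : ℕ} (g : C.Grp (l + 1)) (s : ℕ → Bool) : Fin (C.numMid g) :=
  C.retA g (C.exit (C.callA g) s)

/-- The exit vertex of `g` reached from the middle vertex `m` by the stream `s`. -/
def out (C : MockCFLOBDD k V) {l : ℕ} (g : C.Grp (l + 1)) (m : Fin (C.numMid g)) (s : ℕ → Bool) :
    Fin (C.numExits g) :=
  C.retB g m (C.exit (C.callB g m) s)

theorem exit_congr {l : ℕ} (g : C.Grp l) {s t : ℕ → Bool} (h : ∀ i < 2 ^ l, s i = t i) :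
    C.exit g s = C.exit g t := by
  unfold exit
  congr 1
  funext i
  exact h i i.isLt

theorem exit_succ {l : ℕ} (g : C.Grp (l + 1)) (s : ℕ → Bool) :
    C.exit g s = C.out g (C.mid g s) fun i => s (2 ^ l + i) := rfl

theorem exit_zero {g : C.Grp 0} (s : ℕ → Bool) :
    (C.exit g s : ℕ) = if C.isFork g && s 0 then 1 else 0 := rfl

theorem mid_congr {l : ℕ} (g : C.Grp (l + 1)) {s t : ℕ → Bool} (h : ∀ i < 2 ^ l, s i = t i) :
    C.mid g s = C.mid g t := by
  unfold mid
  rw [exit_congr _ h]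

theorem exit_splice {l : ℕ} (g : C.Grp (l + 1)) (s t : ℕ → Bool) :
    C.exit g (splice (2 ^ l) s t) = C.out g (C.mid g s) t := by
  rw [exit_succ]
  simp only [splice_add]
  rw [mid_congr g fun i hi => splice_of_lt s t hi]

theorem sameProto_refl (C : MockCFLOBDD k V) : ∀ {l : ℕ} (g : C.Grp l), C.SameProto g g
  | 0, _ => by simp [SameProto]
  | _ + 1, g => by
    rw [SameProto]
    exact ⟨rfl, sameProto_refl C _, rfl, rfl, fun m => ⟨sameProto_refl C _, rfl⟩⟩

namespace IsCFLOBDD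

variable (hC : C.IsCFLOBDD)
include hC

theorem numExits_callA {l : ℕ} (g : C.Grp (l + 1)) : C.numExits (C.callA g) = C.numMid g := by
  simpa [tupleA] using congrArg List.length (hC.retA_onto g)

theorem retA_val {l : ℕ} (g : C.Grp (l + 1)) (e : Fin (C.numExits (C.callA g))) :
    (C.retA g e : ℕ) = e := by
  have h := congrArg (fun L => L[(e : ℕ)]?) (hC.retA_onto g)
  simpa [tupleA, ← hC.numExits_callA g] using h

theorem mid_val {l : ℕ} (g : C.Grp (l + 1)) (s : ℕ → Bool) :
    (C.mid g s : ℕ) = C.exit (C.callA g) s := hC.retA_val g _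

theorem exit_surjective : ∀ {l : ℕ} (g : C.Grp l), Function.Surjective (C.exit g)
  | 0, g, e => by
    refine ⟨fun _ => decide ((e : ℕ) = 1), Fin.ext ?_⟩
    have he := e.isLt
    have h0 := C.numExits_zero g
    rw [exit_zero]
    cases h : C.isFork g <;> simp only [h] at h0 ⊢ <;> simp at h0 ⊢ <;> grind
  | l + 1, g, e => by
    obtain ⟨m, b, rfl⟩ := hC.retB_cover g e
    obtain ⟨s, hs⟩ := exit_surjective (C.callA g) ⟨m, by rw [hC.numExits_callA]; exact m.isLt⟩
    obtain ⟨t, rfl⟩ := exit_surjective (C.callB g m) b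
    have hm : C.mid g s = m := Fin.ext (by rw [hC.mid_val, hs])
    exact ⟨splice (2 ^ l) s t, by rw [exit_splice, hm]; rfl⟩

theorem mid_surjective {l : ℕ} (g : C.Grp (l + 1)) : Function.Surjective (C.mid g) := fun m => by
  obtain ⟨s, hs⟩ := hC.exit_surjective (C.callA g) ⟨m, by rw [hC.numExits_callA]; exact m.isLt⟩
  exact ⟨s, Fin.ext (by rw [hC.mid_val, hs])⟩

theorem mem_tupleB {l : ℕ} (g : C.Grp (l + 1)) (m : Fin (C.numMid g)) (v : ℕ) :
    v ∈ C.tupleB g m ↔ ∃ s, (C.out g m s : ℕ) = v := by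
  simp only [tupleB, List.mem_ofFn]
  exact ⟨fun ⟨e, he⟩ => (hC.exit_surjective _ e).imp fun s hs => by rw [out, hs, he],
    fun ⟨s, hs⟩ => ⟨_, hs⟩⟩

theorem exitsBefore_le_iff {l : ℕ} (g : C.Grp (l + 1)) (m : Fin (C.numMid g)) (b : ℕ) :
    C.exitsBefore g m ≤ b ↔ ∀ j < m, ∀ s, (C.out g j s : ℕ) < b := by
  simp only [exitsBefore, Finset.sup_le_iff, Finset.mem_filter, Finset.mem_univ, true_and,
    true_implies, Nat.succ_le_iff]
  exact forall₂_congr fun j _ => ⟨fun h s => h _, fun h e => by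
    obtain ⟨s, rfl⟩ := hC.exit_surjective _ e
    exact h s⟩

/-- The exits targeted by the middle vertices before `m` form an initial segment. -/
theorem exists_out_eq_of_lt_exitsBefore {l : ℕ} (g : C.Grp (l + 1)) (m : Fin (C.numMid g)) {v : ℕ}
    (hv : v < C.exitsBefore g m) : ∃ j < m, ∃ s, (C.out g j s : ℕ) = v := by
  induction m using WellFoundedLT.induction with
  | ind m ih =>
    have h := mt (hC.exitsBefore_le_iff g m v).2 (not_le.2 hv)
    push Not at h
    obtain ⟨j, hj, s, hs⟩ := h
    by_cases hvj : v < C.exitsBefore g j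
    · obtain ⟨i, hi, h⟩ := ih j hj hvj
      exact ⟨i, hi.trans hj, h⟩
    · refine ⟨j, hj, (hC.mem_tupleB g j v).1 ?_⟩
      obtain ⟨r, hr⟩ := hC.retB_compact g j
      have h1 : (C.out g j s : ℕ) ∈ List.range' (C.exitsBefore g j) r := by
        rw [← hr, List.mem_filter]
        exact ⟨(hC.mem_tupleB g j _).2 ⟨s, rfl⟩, by simp; omega⟩
      have h2 : v ∈ List.range' (C.exitsBefore g j) r := by
        rw [List.mem_range'_1] at h1 ⊢
        omega
      rw [← hr] at h2
      exact (List.mem_filter.1 h2).1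

/-- Every exit is reached by a stream, so tuples indexed by the exits of equal callees can be
compared along streams, without casts. -/
theorem ofFn_eq_ofFn {l : ℕ} {c c' : C.Grp l} (h : c = c') {a : Fin (C.numExits c) → ℕ}
    {b : Fin (C.numExits c') → ℕ} (hab : ∀ s, a (C.exit c s) = b (C.exit c' s)) :
    List.ofFn a = List.ofFn b := by
  subst h
  congr 1
  exact funext ((hC.exit_surjective c).forall.2 hab)

end IsCFLOBDD

/-! ### Canonicity of groupings -/

/-- The entries below `n` agree, so those at or above `n` occupy the same positions in both tuples,
where each tuple counts `n, n + 1, …` in order. -/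
theorem eq_of_filter_ofFn_eq_range' {N n r r' : ℕ} {a b : Fin N → ℕ}
    (ha : (List.ofFn a).filter (fun e => n ≤ e) = List.range' n r)
    (hb : (List.ofFn b).filter (fun e => n ≤ e) = List.range' n r')
    (hab : ∀ i, a i < n ∨ b i < n → a i = b i) : a = b := by
  rw [List.ofFn_eq_map, List.filter_map] at ha hb
  have hp : (fun e => decide (n ≤ e)) ∘ b = (fun e => decide (n ≤ e)) ∘ a := by
    funext i
    have := hab i
    simp only [Function.comp, decide_eq_decide]
    omega
  rw [hp] at hb
  have hr := congrArg List.length ha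
  have hr' := congrArg List.length hb
  simp only [List.length_map, List.length_range'] at hr hr'
  rw [← hr', hr, ← ha] at hb
  funext i
  by_cases hi : a i < n
  · exact hab i (Or.inl hi)
  · exact (List.map_inj_left.1 hb i (by simp; omega)).symm

namespace IsCFLOBDD

variable (hC : C.IsCFLOBDD)
include hC

theorem exit_eq_of_filter {l n r r' : ℕ} {c c' : C.Grp l} (h : c = c')
    {a : Fin (C.numExits c) → ℕ} {b : Fin (C.numExits c') → ℕ}
    (ha : (List.ofFn a).filter (fun e => n ≤ e) = List.range' n r)
    (hb : (List.ofFn b).filter (fun e => n ≤ e) = List.range' n r')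
    (hab : ∀ s, a (C.exit c s) < n ∨ b (C.exit c' s) < n → a (C.exit c s) = b (C.exit c' s))
    (s : ℕ → Bool) : a (C.exit c s) = b (C.exit c' s) := by
  subst h
  rw [eq_of_filter_ofFn_eq_range' ha hb ((hC.exit_surjective c).forall.2 hab)]

/-- Exits are numbered in the order of their first use, so that the numbering is determined by the
callees and by the partition of the assignments. -/
theorem out_val_eq {l : ℕ} {g h : C.Grp (l + 1)} (e : C.numMid g = C.numMid h)
    (hA : C.callA g = C.callA h) (hB : ∀ m, C.callB g m = C.callB h (Fin.cast e m))
    (hgh : ∀ s t, C.exit g s = C.exit g t ↔ C.exit h s = C.exit h t) (m : Fin (C.numMid g)) :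
    ∀ s, (C.out g m s : ℕ) = C.out h (Fin.cast e m) s := by
  -- The partition hypothesis, restated for middle vertices, each of which is reached by some
  -- prefix.
  have key : ∀ m m' s s', C.out g m s = C.out g m' s' ↔
      C.out h (Fin.cast e m) s = C.out h (Fin.cast e m') s' := fun m m' s s' => by
    have hmid : ∀ t, Fin.cast e (C.mid g t) = C.mid h t := fun t => Fin.ext (by
      rw [Fin.val_cast, hC.mid_val, hC.mid_val, hA])
    obtain ⟨x, rfl⟩ := hC.mid_surjective g m
    obtain ⟨y, rfl⟩ := hC.mid_surjective g m'
    rw [hmid, hmid, ← exit_splice, ← exit_splice, ← exit_splice, ← exit_splice]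
    exact hgh _ _
  induction m using WellFoundedLT.induction with
  | ind m ih =>
    have hn : C.exitsBefore h (Fin.cast e m) = C.exitsBefore g m := by
      refine eq_of_forall_ge_iff fun b => ?_
      rw [hC.exitsBefore_le_iff, hC.exitsBefore_le_iff]
      constructor
      · intro H j hj s
        rw [ih j hj]
        exact H _ (by simpa using hj) s
      · intro H j hj s
        have hj' : Fin.cast e.symm j < m := by
          rw [Fin.lt_def] at hj ⊢
          simpa using hj
        have := H _ hj' s
        rwa [ih _ hj'] at this
    obtain ⟨r, hr⟩ := hC.retB_compact g m
    obtain ⟨r', hr'⟩ := hC.retB_compact h (Fin.cast e m)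
    rw [hn] at hr'
    refine hC.exit_eq_of_filter (hB m) hr hr' ?_
    rintro s (hs | hs)
    -- An old exit was already hit from an earlier `j`; `key` carries this coincidence over to `h`,
    -- and induction gives its number.
    · obtain ⟨j, hj, t, ht⟩ := hC.exists_out_eq_of_lt_exitsBefore g m hs
      have h1 := (key j m t s).1 (Fin.ext ht)
      exact ht.symm.trans ((ih j hj t).trans (congrArg Fin.val h1))
    · rw [← hn] at hs
      obtain ⟨j, hj, t, ht⟩ := hC.exists_out_eq_of_lt_exitsBefore h (Fin.cast e m) hs
      have hj' : Fin.cast e.symm j < m := by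
        rw [Fin.lt_def] at hj ⊢
        simpa using hj
      have h1 := (key (Fin.cast e.symm j) m t s).2 (Fin.ext ht)
      exact (congrArg Fin.val h1).symm.trans ((ih _ hj' t).trans ht)

theorem out_eq_out_iff {l : ℕ} (g : C.Grp (l + 1)) (m : Fin (C.numMid g)) (s t : ℕ → Bool) :
    C.out g m s = C.out g m t ↔ C.exit (C.callB g m) s = C.exit (C.callB g m) t :=
  (hC.retB_injective g m).eq_iff

/-- If groupings at level `l` are determined by the partition of the assignments, then different
middle vertices of a grouping at level `l + 1` are distinguished by some continuation. -/
theorem eq_of_out_eq_of_canonical {l : ℕ} (ih : ∀ g h : C.Grp l,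
      (∀ s t, C.exit g s = C.exit g t ↔ C.exit h s = C.exit h t) → g = h)
    {g : C.Grp (l + 1)} {m m' : Fin (C.numMid g)} (h : ∀ s, C.out g m s = C.out g m' s) :
    m = m' := by
  by_contra hne
  -- Since B-returns are injective, equal outputs force equal callees, and then equal return tuples,
  -- against `retB_distinct`.
  have hc : C.callB g m = C.callB g m' := ih _ _ fun s t => by
    rw [← hC.out_eq_out_iff, ← hC.out_eq_out_iff, h, h]
  refine hC.retB_distinct g m m' hne (hc ▸ C.sameProto_refl _) ?_
  exact hC.ofFn_eq_ofFn hc fun s => congrArg Fin.val (h s)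

/-- Prefixes with the same continuations reach the same middle vertex, and A-returns are the
identity. Canonicity one level down is a hypothesis because this is used inside the induction that
proves it. -/
theorem exit_callA_eq_iff_of_canonical {l : ℕ} (ih : ∀ g h : C.Grp l,
      (∀ s t, C.exit g s = C.exit g t ↔ C.exit h s = C.exit h t) → g = h)
    (g : C.Grp (l + 1)) (s t : ℕ → Bool) :
    C.exit (C.callA g) s = C.exit (C.callA g) t ↔
      ∀ u, C.exit g (splice (2 ^ l) s u) = C.exit g (splice (2 ^ l) t u) := by
  simp only [exit_splice]
  refine ⟨fun H u => by rw [mid, H, mid], fun H => Fin.ext ?_⟩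
  rw [← hC.mid_val, ← hC.mid_val, hC.eq_of_out_eq_of_canonical ih H]

/-- Canonicity: groupings that induce the same partition of the assignments are equal. -/
theorem eq_of_exit_eq_iff : ∀ {l : ℕ} (g h : C.Grp l),
    (∀ s t, C.exit g s = C.exit g t ↔ C.exit h s = C.exit h t) → g = h
  | 0, g, h, hgh => by
    apply hC.shared
    rw [SameProto]
    have := hgh (fun _ => true) (fun _ => false)
    simp only [Fin.ext_iff, exit_zero] at this
    cases hg : C.isFork g <;> cases hh : C.isFork h <;> simp_all
  | l + 1, g, h, hgh => by
    have ih : ∀ g h : C.Grp l,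
      (∀ s t, C.exit g s = C.exit g t ↔ C.exit h s = C.exit h t) → g = h := eq_of_exit_eq_iff
    have hA : C.callA g = C.callA h := ih _ _ fun s t => by
      rw [hC.exit_callA_eq_iff_of_canonical ih, hC.exit_callA_eq_iff_of_canonical ih]
      exact forall_congr' fun u => hgh _ _
    have e : C.numMid g = C.numMid h := by rw [← hC.numExits_callA, hA, hC.numExits_callA]
    have hcast : ∀ t, Fin.cast e (C.mid g t) = C.mid h t := fun t => Fin.ext (by
      rw [Fin.val_cast, hC.mid_val, hC.mid_val, hA])
    have hB : ∀ m, C.callB g m = C.callB h (Fin.cast e m) := fun m => ih _ _ fun s t => by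
      obtain ⟨x, rfl⟩ := hC.mid_surjective g m
      rw [← hC.out_eq_out_iff, ← hC.out_eq_out_iff, hcast, ← exit_splice, ← exit_splice,
        ← exit_splice, ← exit_splice]
      exact hgh _ _
    have hout := hC.out_val_eq e hA hB hgh
    have hval : ∀ s, (C.exit g s : ℕ) = C.exit h s := fun s => by
      rw [exit_succ, exit_succ, hout, hcast]
    have hle : ∀ g h : C.Grp (l + 1), (∀ s, (C.exit g s : ℕ) = C.exit h s) →
        C.numExits g ≤ C.numExits h := fun g h hval => by
      by_contra! hlt
      obtain ⟨s, hs⟩ := hC.exit_surjective g ⟨C.numExits h, hlt⟩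
      have := hval s
      rw [hs] at this
      exact (C.exit h s).isLt.ne this.symm
    apply hC.shared
    rw [SameProto]
    refine ⟨le_antisymm (hle g h hval) (hle h g fun s => (hval s).symm), hA ▸ C.sameProto_refl _,
      by rw [hC.retA_onto, hC.retA_onto, e], e, fun m => ⟨hB m ▸ C.sameProto_refl _, ?_⟩⟩
    exact hC.ofFn_eq_ofFn (hB m) (hout m)

theorem exit_callA_eq_iff {l : ℕ} (g : C.Grp (l + 1)) (s t : ℕ → Bool) :
    C.exit (C.callA g) s = C.exit (C.callA g) t ↔
      ∀ u, C.exit g (splice (2 ^ l) s u) = C.exit g (splice (2 ^ l) t u) :=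
  hC.exit_callA_eq_iff_of_canonical hC.eq_of_exit_eq_iff g s t

theorem exit_callB_eq_iff {l : ℕ} (g : C.Grp (l + 1)) (x s t : ℕ → Bool) :
    C.exit (C.callB g (C.mid g x)) s = C.exit (C.callB g (C.mid g x)) t ↔
      C.exit g (splice (2 ^ l) x s) = C.exit g (splice (2 ^ l) x t) := by
  rw [exit_splice, exit_splice]
  exact (hC.retB_injective g _).eq_iff.symm

end IsCFLOBDD

end MockCFLOBDD

/-! ### Paths and widths in a BDD -/

namespace DecisionDiagram

variable {n : ℕ} {V : Type*} {B : DecisionDiagram n V}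

/-- The node at depth `d` reached from the root by the stream `s`. -/
def path (B : DecisionDiagram n V) (s : ℕ → Bool) (d : ℕ) (h : d ≤ n) : B.Node d :=
  B.walk (fun i => s i) d h

theorem path_succ (s : ℕ → Bool) {d : ℕ} (h : d + 1 ≤ n) :
    B.path s (d + 1) h = B.child h (B.path s d (Nat.le_of_succ_le h)) (s d) := rfl

theorem path_congr {s t : ℕ → Bool} :
    ∀ {d : ℕ} (h : d ≤ n), (∀ i < d, s i = t i) → B.path s d h = B.path t d h
  | 0, _, _ => rfl
  | d + 1, h, hst => by
    rw [path_succ, path_succ, hst d d.lt_succ_self,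
      path_congr (Nat.le_of_succ_le h) fun i hi => hst i (hi.trans d.lt_succ_self)]

theorem path_splice {d : ℕ} (h : d ≤ n) (s u : ℕ → Bool) :
    B.path (splice d s u) d h = B.path s d h :=
  path_congr h fun _ hi => splice_of_lt s u hi

theorem path_splice_eq {d e : ℕ} (hde : d ≤ e) (he : e ≤ n) {s t : ℕ → Bool}
    (hst : B.path s d (hde.trans he) = B.path t d (hde.trans he)) (u : ℕ → Bool) :
    B.path (splice d s u) e he = B.path (splice d t u) e he := by
  obtain ⟨m, rfl⟩ := Nat.exists_eq_add_of_le hde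
  induction m with
  | zero => simpa only [Nat.add_zero, path_splice] using hst
  | succ m ih =>
    change B.child he (B.path (splice d s u) (d + m) _) (splice d s u (d + m)) =
      B.child he (B.path (splice d t u) (d + m) _) (splice d t u (d + m))
    rw [ih (by omega) _ hst, splice_add, splice_add]

/-- Sharing pulls equality up one ply at a time: nodes with equal successors coincide. -/
theorem IsBDD.path_eq_of_path_splice_eq (hB : B.IsBDD) {d e : ℕ} (hde : d ≤ e) (he : e ≤ n)
    {s t : ℕ → Bool} (hst : ∀ u, B.path (splice d s u) e he = B.path (splice d t u) e he) :
    B.path s d (hde.trans he) = B.path t d (hde.trans he) := by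
  obtain ⟨m, rfl⟩ := Nat.exists_eq_add_of_le hde
  induction m with
  | zero => simpa only [Nat.add_zero, path_splice, forall_const] using hst
  | succ m ih =>
    refine ih (by omega) (by omega) fun u => hB.shared (by omega) _ _ fun b => ?_
    -- This continuation follows `u` to depth `d + m` and then takes the `b`-successor.
    have h := hst (splice m u fun _ => b)
    rw [splice_splice, splice_splice] at h
    change B.child he (B.path (splice (d + m) _ _) (d + m) _) (splice (d + m) _ _ (d + m)) =
      B.child he (B.path (splice (d + m) _ _) (d + m) _) (splice (d + m) _ _ (d + m)) at h
    rw [path_splice, path_splice] at h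
    simpa [splice] using h

theorem IsBDD.path_eq_iff (hB : B.IsBDD) {d e : ℕ} (hde : d ≤ e) (he : e ≤ n) {s t : ℕ → Bool} :
    B.path s d (hde.trans he) = B.path t d (hde.trans he) ↔
      ∀ u, B.path (splice d s u) e he = B.path (splice d t u) e he :=
  ⟨path_splice_eq hde he, hB.path_eq_of_path_splice_eq hde he⟩

/-- The number of nodes at depth `d`, if `d ≤ n`. -/
def width (B : DecisionDiagram n V) (d : ℕ) : ℕ :=
  if d ≤ n then Fintype.card (B.Node d) else 0

/-- Depths beyond `n` have width zero, so `p` need not stay within range. -/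
theorem sum_width_le_size {ι : Type*} (S : Finset ι) {p : ι → ℕ} (hp : Set.InjOn p S) :
    ∑ i ∈ S, B.width (p i) ≤ B.size := by
  rw [← Finset.sum_image hp]
  unfold width size
  rw [← Finset.sum_filter]
  refine Finset.sum_le_sum_of_subset fun d hd => ?_
  have := (Finset.mem_filter.1 hd).2
  exact Finset.mem_range.2 (by omega)

end DecisionDiagram

/-! ### Groupings track BDD nodes -/

namespace MockCFLOBDD

variable {n k : ℕ} {V : Type*} {C : MockCFLOBDD k V} {B : DecisionDiagram n V}

/-- After the prefix of length `d` of `X`, the grouping `g` distinguishes exactly the assignments to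
the next `2 ^ l` variables that lead to different nodes of `B`. -/
def Tracks (C : MockCFLOBDD k V) (B : DecisionDiagram n V) {l : ℕ} (g : C.Grp l) (d : ℕ)
    (X : ℕ → Bool) : Prop :=
  -- A free `e` avoids transport in `B.Node e` between `d + 2 ^ l + 2 ^ l` and `d + 2 ^ (l + 1)`.
  ∀ e, e = d + 2 ^ l → ∃ h : e ≤ n, ∀ s t, C.exit g s = C.exit g t ↔
    B.path (splice d X s) e h = B.path (splice d X t) e h

namespace Tracks

variable {l d : ℕ} {X : ℕ → Bool}

theorem le {g : C.Grp l} (hg : C.Tracks B g d X) : d + 2 ^ l ≤ n := (hg _ rfl).1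

/-- Halfway points are told apart by their continuations, both in `g` and in the shared diagram `B`.
-/
theorem callA {g : C.Grp (l + 1)} (hg : C.Tracks B g d X) (hC : C.IsCFLOBDD) (hB : B.IsBDD) :
    C.Tracks B (C.callA g) d X := by
  rintro e rfl
  obtain ⟨h, H⟩ := hg _ rfl
  have hle : d + 2 ^ l ≤ d + 2 ^ (l + 1) := by rw [pow_succ]; omega
  refine ⟨hle.trans h, fun s t => ?_⟩
  rw [hC.exit_callA_eq_iff, hB.path_eq_iff hle h]
  simp only [H, splice_splice]

theorem callB {g : C.Grp (l + 1)} (hg : C.Tracks B g d X) (hC : C.IsCFLOBDD) (x : ℕ → Bool) :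
    C.Tracks B (C.callB g (C.mid g x)) (d + 2 ^ l) (splice d X x) := by
  rintro e he
  obtain ⟨h, H⟩ := hg e (by rw [he, pow_succ]; omega)
  refine ⟨h, fun s t => ?_⟩
  rw [hC.exit_callB_eq_iff, H, splice_splice, splice_splice]

theorem numExits_le {g : C.Grp l} (hg : C.Tracks B g d X) (hC : C.IsCFLOBDD) :
    C.numExits g ≤ B.width (d + 2 ^ l) := by
  obtain ⟨h, H⟩ := hg _ rfl
  rw [DecisionDiagram.width, if_pos h, ← Fintype.card_fin (C.numExits g)]
  choose s hs using hC.exit_surjective g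
  refine Fintype.card_le_of_injective (fun e => B.path (splice d X (s e)) _ h) fun e e' hee => ?_
  rw [← hs e, ← hs e', H]
  exact hee

/-- The node at depth `d` fixes how `B` continues, hence the partition, hence by canonicity the
grouping. -/
theorem eq (hC : C.IsCFLOBDD) {g g' : C.Grp l} {X' : ℕ → Bool} (hg : C.Tracks B g d X)
    (hg' : C.Tracks B g' d X') (hd : d ≤ n) (hX : B.path X d hd = B.path X' d hd) : g = g' := by
  obtain ⟨h, H⟩ := hg _ rfl
  obtain ⟨_, H'⟩ := hg' _ rfl
  refine hC.eq_of_exit_eq_iff _ _ fun s t => ?_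
  rw [H, H', DecisionDiagram.path_splice_eq (Nat.le_add_right _ _) h hX,
    DecisionDiagram.path_splice_eq (Nat.le_add_right _ _) h hX]

end Tracks

/-- Exits of the head and leaves of `B` are both identified by their terminal values; at depth `0`
the prefix is empty, so `X` is arbitrary. -/
theorem tracks_head {f : (Fin (2 ^ k) → Bool) → V} {Ord : Equiv.Perm (Fin (2 ^ k))}
    {B : DecisionDiagram (2 ^ k) V} (hB : B.IsBDD) (hBf : B.Represents Ord f) (hC : C.IsCFLOBDD)
    (hCf : C.Represents Ord f) (X : ℕ → Bool) : C.Tracks B C.head 0 X := by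
  rintro e he
  obtain rfl : e = 2 ^ k := by omega
  refine ⟨le_rfl, fun s t => ?_⟩
  have key : ∀ s, C.value (C.exit C.head s) = B.value (B.path s _ le_rfl) := fun s => by
    have h1 := hCf fun j => s (Ord.symm j)
    have h2 := hBf fun j => s (Ord.symm j)
    simp only [Equiv.symm_apply_apply] at h1 h2
    exact h1.trans h2.symm
  rw [← hC.value_injective.eq_iff, key, key, hB.value_injective.eq_iff, splice_zero, splice_zero]

theorem exists_tracks {f : (Fin (2 ^ k) → Bool) → V} {Ord : Equiv.Perm (Fin (2 ^ k))}
    {B : DecisionDiagram (2 ^ k) V} (hB : B.IsBDD) (hBf : B.Represents Ord f) (hC : C.IsCFLOBDD)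
    (hCf : C.Represents Ord f) {l : ℕ} (g : C.Grp l) : ∃ d X, C.Tracks B g d X := by
  induction hC.reachable g with
  | head => exact ⟨0, fun _ => false, tracks_head hB hBf hC hCf _⟩
  | callA _ ih =>
    obtain ⟨d, X, h⟩ := ih
    exact ⟨d, X, h.callA hC hB⟩
  | callB m _ ih =>
    obtain ⟨d, X, h⟩ := ih
    obtain ⟨x, rfl⟩ := hC.mid_surjective _ m
    exact ⟨_, _, h.callB hC x⟩

/-! ### Counting vertices -/

/-- A bound for the vertices of a grouping at level `l` that tracks `B` from depth `d` on. -/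
def vertexBound (B : DecisionDiagram n V) : ℕ → ℕ → ℕ
  | 0, d => 2 * B.width (d + 2 ^ 0)
  | l + 1, d => B.width (d + 2 ^ l) + 2 * B.width (d + 2 ^ (l + 1))

theorem Tracks.numVertices_le {l d : ℕ} {X : ℕ → Bool} {g : C.Grp l} (hg : C.Tracks B g d X)
    (hC : C.IsCFLOBDD) (hB : B.IsBDD) :
    1 + C.numMiddle g + C.numExits g ≤ vertexBound B l d := by
  -- There is at least one exit, so a second copy of the exit bound pays for the entry vertex.
  have h0 : 0 < C.numExits g := (C.exit g fun _ => false).pos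
  have h1 := hg.numExits_le hC
  cases l with
  | zero =>
    simp only [numMiddle, vertexBound]
    omega
  | succ l =>
    have h2 := (hg.callA hC hB).numExits_le hC
    rw [hC.numExits_callA] at h2
    simp only [numMiddle, vertexBound]
    omega

/-- The depths `d + 2 ^ l` are distinct, so middle vertices cost at most `B.size` over all levels,
and the doubled exit term at most `2 * B.size`. -/
theorem sum_vertexBound_le (B : DecisionDiagram n V) (k d : ℕ) :
    ∑ l ∈ Finset.range (k + 1), vertexBound B l d ≤ 3 * B.size := by
  have hinj : ∀ S : Set ℕ, Set.InjOn (fun l => d + 2 ^ l) S := fun S a _ b _ hab =>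
    Nat.pow_right_injective le_rfl (Nat.add_left_cancel hab)
  have h1 := B.sum_width_le_size (Finset.range k) (hinj _)
  have h2 := B.sum_width_le_size (Finset.range (k + 1)) (hinj _)
  rw [Finset.sum_range_succ'] at h2 ⊢
  simp only [vertexBound, Finset.sum_add_distrib, ← Finset.mul_sum]
  omega

theorem IsCFLOBDD.sum_numVertices_le (hC : C.IsCFLOBDD) (hB : B.IsBDD) {l : ℕ}
    (h : ∀ g : C.Grp l, ∃ d X, C.Tracks B g d X) :
    ∑ g : C.Grp l, (1 + C.numMiddle g + C.numExits g) ≤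
      ∑ d : Fin (n + 1), Fintype.card (B.Node d) * vertexBound B l d := by
  choose d X hg using h
  have hd : ∀ g, d g ≤ n := fun g => (Nat.le_add_right _ _).trans (hg g).le
  let φ : C.Grp l → Σ d : Fin (n + 1), B.Node d :=
    fun g => ⟨⟨d g, Nat.lt_succ_of_le (hd g)⟩, B.path (X g) (d g) (hd g)⟩
  have hφ : Function.Injective φ := fun g g' hgg => by
    -- The depths become variables so that their equality can be substituted in the dependent pairs.
    have key : ∀ (a b : ℕ) (ha : a ≤ n) (hb : b ≤ n), C.Tracks B g a (X g) →
        C.Tracks B g' b (X g') →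
        (⟨⟨a, Nat.lt_succ_of_le ha⟩, B.path (X g) a ha⟩ : Σ d : Fin (n + 1), B.Node d) =
          ⟨⟨b, Nat.lt_succ_of_le hb⟩, B.path (X g') b hb⟩ → g = g' := by
      intro a b ha hb h1 h2 hab
      obtain rfl : a = b := congrArg (fun p => (p.1 : ℕ)) hab
      exact h1.eq hC h2 ha (eq_of_heq (Sigma.mk.inj hab).2)
    exact key _ _ (hd g) (hd g') (hg g) (hg g') hgg
  calc ∑ g : C.Grp l, (1 + C.numMiddle g + C.numExits g)
      ≤ ∑ g : C.Grp l, vertexBound B l (φ g).1 :=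
        Finset.sum_le_sum fun g _ => (hg g).numVertices_le hC hB
    _ = ∑ p ∈ Finset.univ.map ⟨φ, hφ⟩, vertexBound B l p.1 := by
        rw [Finset.sum_map]
        rfl
    _ ≤ ∑ p : Σ d : Fin (n + 1), B.Node d, vertexBound B l p.1 :=
        Finset.sum_le_sum_of_subset (Finset.subset_univ _)
    _ = _ := by
        rw [Fintype.sum_sigma]
        simp

end MockCFLOBDD

theorem mainTheorem3 :
    ∃ c : ℕ, ∀ (V : Type*) (k : ℕ) (f : (Fin (2 ^ k) → Bool) → V)
      (Ord : Equiv.Perm (Fin (2 ^ k))) (B : DecisionDiagram (2 ^ k) V) (C : MockCFLOBDD k V),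
      B.IsBDD → B.Represents Ord f → C.IsCFLOBDD → C.Represents Ord f →
        C.numVertices ≤ c * B.size ^ 2 := by
  refine ⟨3, fun V k f Ord B C hB hBf hC hCf => ?_⟩
  calc C.numVertices
      ≤ ∑ l ∈ Finset.range (k + 1), ∑ d : Fin (2 ^ k + 1),
          Fintype.card (B.Node d) * MockCFLOBDD.vertexBound B l d :=
        Finset.sum_le_sum fun l _ => hC.sum_numVertices_le hB
          (MockCFLOBDD.exists_tracks hB hBf hC hCf)
    _ = ∑ d : Fin (2 ^ k + 1), Fintype.card (B.Node d) *
          ∑ l ∈ Finset.range (k + 1), MockCFLOBDD.vertexBound B l d := by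
        rw [Finset.sum_comm]
        simp only [Finset.mul_sum]
    _ ≤ ∑ d : Fin (2 ^ k + 1), Fintype.card (B.Node d) * (3 * B.size) :=
        Finset.sum_le_sum fun d _ =>
          Nat.mul_le_mul_left _ (MockCFLOBDD.sum_vertexBound_le B k d)
    _ = 3 * B.size ^ 2 := by
        rw [← Finset.sum_mul, Fin.sum_univ_eq_sum_range fun d => Fintype.card (B.Node d)]
        change B.size * (3 * B.size) = _
        ring
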